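/- Setting. Let $\mathbb{C}^d$ ($d\ge 1$) be a local space with basis $|0\rangle,\dots,|d-1\rangle$ and parities $|n|\in\mathbb{Z}_2$, and let the auxiliary space $\mathbb{C}^D$ be graded by a parity operator $Z$ that is diagonal with entries $\pm1$. A tensor $\mathcal{A}=(A^j)_j$ of $D\times D$ complex matrices, indexed by a finite set of indices $j$ with parities $|j|\in\mathbb{Z}_2$, is *even* if $ZA^j=(-1)^{|j|}A^jZ$ for all $j$; its transfer matrix is $E=\sum_j A^j\otimes\bar A^j$. A tensor $\mathcal U=(U^{n,m})_{n,m=0}^{d-1}$ is treated as such a tensor with the index $(n,m)$ of parity $|n|+|m|$. An even tensor is *graded normal* if (i) the only orthogonal projectors $P$ with $PZ=ZP$ and $A^jP=PA^jP$ for all $j$ are $0$ and $\mathbb{1}$, and (ii) $E$ has spectral radius $1$ and, counted with algebraic multiplicity, either exactly one or exactly two eigenvalues of magnitude $1$, all of them equal to $1$. It is *non-degenerate* in the first case and *degenerate* in the second. An even tensor is in *graded canonical form* if, after a partition of the basis of the auxiliary space into blocks, $A^j=\bigoplus_{k=1}^r\mu_kA^j_k$ with $\mu_k\in\mathbb{C}\setminus\{0\}$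 and every $\mathcal{A}_k$ a graded normal tensor for the parity operator given by the corresponding block of $Z$. For $N\ge1$ sites let $a_1^{\dagger t_1}\cdots a_N^{\dagger t_N}|\Omega\rangle$, $0\le t_j\le d-1$, be the Fock basis, and let $f_j^{n,m}$ be the operator that maps this vector to $0$ if $t_j\ne m$ and otherwise to $(-1)^{(|n|+|m|)\sum_{i<j}|t_i|}$ times the basis vector with $t_j$ replaced by $n$. For a $D\times D$ matrix $S$ put $$U_S^{(N)}=\sum_{n_1,\dots,n_N,\,m_1,\dots,m_N}\operatorname{tr}\left(S\,U^{n_1,m_1}\cdots U^{n_N,m_N}\right)f_1^{n_1,m_1}\cdots f_N^{n_N,m_N}.$$ An even tensor $\mathcal U$ *generates a type I fMPU with antiperiodic boundary conditions* if for some $\alpha\in\mathbb{R}$ and $S=e^{i\alpha}\mathbb{1}$ the operator $U_S^{(N)}$ is unitary for all $N\ge1$. It *generates a type II fMPU with antiperiodic boundary conditions* if for some $\alpha\in\mathbb{R}$ and $S=\frac{e^{i\alpha}}{\sqrt2}\mathbb{1}$ the operator $U_S^{(N)}$ is unitary for all $N\ge1$, and the family $(U_S^{(N)})_{N\ge1}$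 can be written as the family $(V_{S'}^{(N)})_{N\ge1}$ of a tensor $V^{n,m}=(\sigma^x)^{|n|+|m|}\otimes M^{n,m}$, with parity operator $\sigma^z\otimes\mathbb{1}$ and $S'=\frac{e^{i\beta}}{\sqrt2}\mathbb{1}$, for some square matrices $M^{n,m}$ (of any common size) and some $\beta\in\mathbb{R}$. Proposition. Let $\mathcal{U}=(U^{n,m})$ be a tensor in graded canonical form. If $\mathcal U$ generates a type I fMPU with antiperiodic boundary conditions, then $\mathcal{U}/\sqrt d$ is graded normal and non-degenerate. If $\mathcal U$ generates a type II fMPU with antiperiodic boundary conditions, then $\mathcal{U}/\sqrt d$ is graded normal and degenerate. -/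

import Mathlib

open scoped Kronecker

noncomputable section

namespace FMPU

/-- The sign `(-1)^a` of a parity `a`. -/
def sgn (a : ZMod 2) : ℂ := (-1) ^ a.val

/-- The parity operator of a space whose basis vector `α` has parity `q α`. -/
def parityOp {κ : Type} [DecidableEq κ] (q : κ → ZMod 2) : Matrix κ κ ℂ :=
  Matrix.diagonal fun α => sgn (q α)

section Tensors

/-! A tensor is a family of matrices `A j` (acting on the auxiliary space with basis `κ`, graded
by `q`), indexed by a physical index `j : J` of parity `π j`. -/

variable {J κ : Type} [Fintype J] [Fintype κ] [DecidableEq κ]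

/-- Even tensors: `Z A^j = (-1)^{|j|} A^j Z`. -/
def IsEvenTensor (π : J → ZMod 2) (q : κ → ZMod 2) (A : J → Matrix κ κ ℂ) : Prop :=
  ∀ j, parityOp q * A j = sgn (π j) • (A j * parityOp q)

/-- The transfer matrix `E = ∑ j, A^j ⊗ conj (A^j)`. -/
def transferMatrix (A : J → Matrix κ κ ℂ) : Matrix (κ × κ) (κ × κ) ℂ :=
  ∑ j, A j ⊗ₖ (A j).map (starRingEnd ℂ)

/-- There is no non-trivial graded subspace left invariant by all `A^j`. A subspace is given by
its orthogonal projector `P`; it is graded if `P` commutes with the parity operator, and it is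
invariant if `A^j P = P A^j P`. -/
def IsGradedIrreducible (q : κ → ZMod 2) (A : J → Matrix κ κ ℂ) : Prop :=
  ∀ P : Matrix κ κ ℂ, IsStarProjection P → Commute P (parityOp q) →
    (∀ j, A j * P = P * A j * P) → P = 0 ∨ P = 1

/-- The tensor is even, graded irreducible, its transfer matrix has spectral radius one, and the
eigenvalues of magnitude one (listed with algebraic multiplicity) are `c` copies of `1`. -/
structure IsGradedNormalWith (c : ℕ) (π : J → ZMod 2) (q : κ → ZMod 2)
    (A : J → Matrix κ κ ℂ) : Prop where
  even : IsEvenTensor π q A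
  irreducible : IsGradedIrreducible q A
  spectralRadius_eq : spectralRadius ℂ (transferMatrix A) = 1
  peripheral : (transferMatrix A).charpoly.roots.filter (fun z => ‖z‖ = 1) =
    Multiset.replicate c 1

/-- Non-degenerate graded normal tensors. -/
def IsGradedNormalNondegenerate (π : J → ZMod 2) (q : κ → ZMod 2)
    (A : J → Matrix κ κ ℂ) : Prop :=
  IsGradedNormalWith 1 π q A

/-- Degenerate graded normal tensors. -/
def IsGradedNormalDegenerate (π : J → ZMod 2) (q : κ → ZMod 2)
    (A : J → Matrix κ κ ℂ) : Prop :=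
  IsGradedNormalWith 2 π q A

/-- Graded normal tensors. -/
def IsGradedNormal (π : J → ZMod 2) (q : κ → ZMod 2) (A : J → Matrix κ κ ℂ) : Prop :=
  IsGradedNormalNondegenerate π q A ∨ IsGradedNormalDegenerate π q A

/-- Graded canonical form: the tensor is even and, for a partition `e` of the auxiliary basis
into `r` blocks, `A^j = ⊕ₖ μ k • A_k^j` with `μ k ≠ 0` and every `A_k` graded normal (so that its
transfer matrix has spectral radius one) for the grading inherited by the `k`-th block. The parity
operator is diagonal, so it has the same block structure. -/
def IsGradedCanonicalForm (π : J → ZMod 2) (q : κ → ZMod 2) (A : J → Matrix κ κ ℂ) : Prop :=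
  IsEvenTensor π q A ∧
  ∃ (r : ℕ) (b : Fin r → ℕ) (e : (Σ k : Fin r, Fin (b k)) ≃ κ) (μ : Fin r → ℂ)
    (B : (k : Fin r) → J → Matrix (Fin (b k)) (Fin (b k)) ℂ),
    (∀ k, μ k ≠ 0) ∧
    (∀ j, A j = Matrix.reindex e e (Matrix.blockDiagonal' fun k => μ k • B k j)) ∧
    ∀ k, IsGradedNormal π (fun a => q (e ⟨k, a⟩)) (B k)

end Tensors

section Operators

/-! Each of the `N` sites carries a graded space with basis `Fin d`, the parity of the `n`-th
vector being `p n`. The configuration `t : Fin N → Fin d` stands for the basis vector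
`(a₁†)^{t 0} ⋯ (a_N†)^{t (N-1)} |Ω⟩`. -/

variable {d : ℕ}

/-- The operator `f_j^{n,m}`: it replaces `m` by `n` at site `j`, and picks up the sign
`(-1)^{(|n|+|m|)|t_i|}` from moving past every site `i` to the left of `j`. -/
def fermiOp (p : Fin d → ZMod 2) {N : ℕ} (j : Fin N) (n m : Fin d) :
    Matrix (Fin N → Fin d) (Fin N → Fin d) ℂ :=
  Matrix.of fun s t =>
    if t j = m ∧ s = Function.update t j n then
      sgn ((p n + p m) * ∑ i ∈ Finset.univ.filter (fun i => i < j), p (t i))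
    else 0

variable {κ : Type} [Fintype κ] [DecidableEq κ]

/-- The fermionic matrix product operator on `N` sites with boundary operator `S`:
`∑_{n,m} tr (S U^{n₁,m₁} ⋯ U^{n_N,m_N}) f₁^{n₁,m₁} ⋯ f_N^{n_N,m_N}`. -/
def fMPO (p : Fin d → ZMod 2) (S : Matrix κ κ ℂ) (U : Fin d × Fin d → Matrix κ κ ℂ) (N : ℕ) :
    Matrix (Fin N → Fin d) (Fin N → Fin d) ℂ :=
  ∑ n : Fin N → Fin d, ∑ m : Fin N → Fin d,
    Matrix.trace (S * (List.ofFn fun j => U (n j, m j)).prod) •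
      (List.ofFn fun j => fermiOp p j (n j) (m j)).prod

/-- The parity `|n| + |m|` of a pair of output and input indices. -/
def opParity (p : Fin d → ZMod 2) (x : Fin d × Fin d) : ZMod 2 := p x.1 + p x.2

/-- The even tensor `U` and the boundary operator `S` (even and commuting with all `U^{n,m}`)
define a generalized fMPU with antiperiodic boundary conditions. -/
structure IsGeneralizedFMPU (p : Fin d → ZMod 2) (q : κ → ZMod 2) (S : Matrix κ κ ℂ)
    (U : Fin d × Fin d → Matrix κ κ ℂ) : Prop where
  even : IsEvenTensor (opParity p) q U
  boundary_even : Commute S (parityOp q)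
  boundary_comm : ∀ x, Commute S (U x)
  unitary : ∀ N : ℕ, 1 ≤ N → fMPO p S U N ∈ Matrix.unitaryGroup (Fin N → Fin d) ℂ

/-- The boundary operator `e^{iα} 𝟙` of type I fMPUs. -/
def boundaryI (κ : Type) [DecidableEq κ] (α : ℝ) : Matrix κ κ ℂ :=
  Complex.exp (α * Complex.I) • 1

/-- The boundary operator `(e^{iα} / √2) 𝟙` of type II fMPUs. -/
def boundaryII (κ : Type) [DecidableEq κ] (α : ℝ) : Matrix κ κ ℂ :=
  (Complex.exp (α * Complex.I) / ((Real.sqrt 2 : ℝ) : ℂ)) • 1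

/-- The tensor `(σˣ)^{|n|+|m|} ⊗ M^{n,m}`. -/
def typeIITensor (p : Fin d → ZMod 2) {b : ℕ}
    (M : Fin d × Fin d → Matrix (Fin b) (Fin b) ℂ) (x : Fin d × Fin d) :
    Matrix (Fin 2 × Fin b) (Fin 2 × Fin b) ℂ :=
  ((!![0, 1; 1, 0] : Matrix (Fin 2) (Fin 2) ℂ) ^ (opParity p x).val) ⊗ₖ M x

/-- The grading with parity operator `σᶻ ⊗ 𝟙`. -/
def typeIIGrading (b : ℕ) (x : Fin 2 × Fin b) : ZMod 2 := x.1

/-- The family of operators `T N` is an fMPU of type II: it is the generalized fMPU with some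
tensor of the form `(σˣ)^{|n|+|m|} ⊗ M^{n,m}` and boundary operator `(e^{iα} / √2) 𝟙`. -/
def IsTypeII (p : Fin d → ZMod 2)
    (T : (N : ℕ) → Matrix (Fin N → Fin d) (Fin N → Fin d) ℂ) : Prop :=
  ∃ (b : ℕ) (α : ℝ) (M : Fin d × Fin d → Matrix (Fin b) (Fin b) ℂ),
    IsGeneralizedFMPU p (typeIIGrading b) (boundaryII _ α) (typeIITensor p M) ∧
    ∀ N : ℕ, 1 ≤ N → T N = fMPO p (boundaryII _ α) (typeIITensor p M) N

/-- The tensor `U` generates a type I fMPU with antiperiodic boundary conditions. -/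
def GeneratesTypeI (p : Fin d → ZMod 2) (q : κ → ZMod 2)
    (U : Fin d × Fin d → Matrix κ κ ℂ) : Prop :=
  ∃ α : ℝ, IsGeneralizedFMPU p q (boundaryI κ α) U

/-- The tensor `U` generates, with a boundary operator `(e^{iα} / √2) 𝟙`, a type II fMPU with
antiperiodic boundary conditions. The tensor `U` itself need not be written in the basis in which
it has the form `(σˣ)^{|n|+|m|} ⊗ M^{n,m}`: only the family of operators has to be of type II. -/
def GeneratesTypeII (p : Fin d → ZMod 2) (q : κ → ZMod 2)
    (U : Fin d × Fin d → Matrix κ κ ℂ) : Prop :=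
  ∃ α : ℝ, IsGeneralizedFMPU p q (boundaryII κ α) U ∧ IsTypeII p (fMPO p (boundaryII κ α) U)

end Operators

end FMPU

end

/-! The fermionic signs are `±1` and drop out of `tr (U_S U_S†)`, so unitarity gives `|c|² tr E^N =
d^N` for `S = c • 1`. After division by `√d`, `tr E^N = a` for all `N ≥ 1`, with `a = 1` (type I) or
`a = 2` (type II). Constant power sums force the nonzero eigenvalues of `E` to be `a` copies of `1`
(`count_eq_of_power_sums`). This settles the spectral conditions; irreducibility remains.

With the weights absorbed into the canonical blocks, `tr E^N` is the sum of `tr E_{kl}^N` over the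
mixed transfer matrices of pairs of blocks. Let `n k` count the eigenvalue `1` in row `k`. Then `∑ n
k = a`, and `n k ≥ 1` because `E_{kk}` has a nonzero eigenvalue
(`exists_multiplicity_of_trace_pow`). For type I this leaves one block, whose irreducibility passes
to the whole tensor.

For type II one needs `n k ≥ 2`. Now `n k` is the overlap of block `k` with the whole tensor, whose
traces agree up to a phase with those of `(σˣ)^{|n|+|m|} ⊗ M`: `2 tr M^w` on even words, zero on odd
ones. As the block is even, this overlap is twice an overlap with `M`, so `n k` is even
(`two_le_of_typeII`). -/

open scoped Kronecker

noncomputable section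

namespace FMPU

/-! ### Eigenvalue multiplicities from traces of powers. -/

section PowerSums

open Polynomial

variable {n : Type*} [Fintype n] [DecidableEq n]

theorem det_aeval_eq_prod_roots (A : Matrix n n ℂ) (f : ℂ[X]) :
    (aeval A f).det = (A.charpoly.roots.map fun z => f.eval z).prod := by
  have hs : A.charpoly.Splits := IsAlgClosed.splits _
  have hlin (a : ℂ) : (A - algebraMap ℂ _ a).det =
      (A.charpoly.roots.map fun z => z - a).prod := by
    have h := hs.eval_eq_prod_roots_of_monic A.charpoly_monic a
    rw [Matrix.eval_charpoly] at h
    have h2 : A - algebraMap ℂ _ a = -(Matrix.scalar n a - A) := by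
      rw [neg_sub]; rfl
    have h3 : (A.charpoly.roots.map fun z => z - a) =
        A.charpoly.roots.map fun z => (-1) * (a - z) := by
      simp
    rw [h2, Matrix.det_neg, h, h3, Multiset.prod_map_mul, Multiset.map_const',
      Multiset.prod_replicate, ← hs.natDegree_eq_card_roots, A.charpoly_natDegree_eq_dim]
  -- Forgetting where the leading coefficient and the roots come from allows an induction on the
  -- linear factors of `f`.
  have hf := (IsAlgClosed.splits f).eq_prod_roots
  generalize f.leadingCoeff = c at hf
  generalize f.roots = s at hf
  subst hf
  induction s using Multiset.induction with
  | empty =>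
    simp [Matrix.algebraMap_eq_diagonal, ← hs.natDegree_eq_card_roots]
  | cons a s ih =>
    rw [Multiset.map_cons, Multiset.prod_cons, mul_left_comm, map_mul, Matrix.det_mul, ih]
    simp only [map_sub, aeval_X, aeval_C, hlin, eval_mul, eval_sub, eval_X, eval_C,
      Multiset.prod_map_mul]

theorem trace_pow_eq_sum_roots (A : Matrix n n ℂ) (N : ℕ) :
    (A ^ N).trace = (A.charpoly.roots.map fun z => z ^ N).sum := by
  have h : (A ^ N).charpoly = ((A.charpoly.roots.map fun z => z ^ N).map (X - C ·)).prod := by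
    refine Polynomial.funext fun t => ?_
    have h1 : Matrix.scalar n t - A ^ N = aeval A (C t - X ^ N) := by
      simp; rfl
    rw [Matrix.eval_charpoly, h1, det_aeval_eq_prod_roots, eval_multiset_prod]
    simp
  rw [Matrix.trace_eq_sum_roots_charpoly, h, roots_multiset_prod_X_sub_C]

/-- Linearity in `f`. The condition `f.eval 0 = 0` removes the constant term, since nothing is known
about the power sum at `N = 0`. -/
theorem sum_map_eval_eq_of_power_sums {R : Multiset ℂ} {a : ℂ}
    (h : ∀ N : ℕ, 1 ≤ N → (R.map fun z => z ^ N).sum = a) {f : ℂ[X]} (hf : f.eval 0 = 0) :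
    (R.map fun z => f.eval z).sum = a * f.eval 1 := by
  obtain ⟨g, rfl⟩ := X_dvd_iff.mpr ((coeff_zero_eq_eval_zero f).trans hf)
  simp only [eval_mul, eval_X, one_mul]
  induction g using Polynomial.induction_on' with
  | add p q hp hq => simp [mul_add, Multiset.sum_map_add, hp (by simp), hq (by simp)]
  | monomial n b =>
    have := h (n + 1) (by omega)
    simp only [pow_succ'] at this
    simp only [eval_monomial, one_pow, mul_one, mul_left_comm _ b, Multiset.sum_map_mul_left, this]
    ring

/-- A test polynomial that vanishes at `0`, at `1` and on `R`, except at `z`, isolates the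
multiplicity of `z`. Keeping `a` complex lets it carry a phase in the type II case. -/
theorem count_eq_of_power_sums {R : Multiset ℂ} {a : ℂ}
    (h : ∀ N : ℕ, 1 ≤ N → (R.map fun z => z ^ N).sum = a) {z : ℂ} (hz : z ≠ 0) :
    (R.count z : ℂ) = if z = 1 then a else 0 := by
  classical
  let s : Finset ℂ := (insert 0 (insert 1 R.toFinset)).erase z
  let f : ℂ[X] := ∏ x ∈ s, (X - C x)
  have hev (y : ℂ) : f.eval y = ∏ x ∈ s, (y - x) := by simp [f, eval_prod]
  have hs {y : ℂ} (hy : y ∈ s) : f.eval y = 0 := by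
    rw [hev]; exact Finset.prod_eq_zero hy (sub_self y)
  have hzz : f.eval z ≠ 0 := by
    rw [hev]
    exact Finset.prod_ne_zero_iff.mpr fun x hx => sub_ne_zero.mpr (Finset.ne_of_mem_erase hx).symm
  have h0 := sum_map_eval_eq_of_power_sums h (f := f) (hs (by simp [s, hz.symm]))
  have h1 : (R.map fun y => f.eval y).sum = R.count z * f.eval z := by
    rw [Finset.sum_multiset_map_count, Finset.sum_eq_single z]
    · simp
    · intro y hy hyz
      rw [hs (by simp [s, hyz]; exact Or.inr (Or.inr (Multiset.mem_toFinset.mp hy))), smul_zero]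
    · intro hz'
      simp [Multiset.count_eq_zero.mpr fun h => hz' (Multiset.mem_toFinset.mpr h)]
  rw [h1] at h0
  split_ifs with h2
  · subst h2; exact mul_right_cancel₀ hzz h0
  · rw [hs (y := 1) (by simp [s, Ne.symm h2]), mul_zero] at h0
    exact (mul_eq_zero.mp h0).resolve_right hzz

end PowerSums

/-! ### Products along words and mixed transfer matrices. -/

section Words

variable {J κ ι : Type} [Fintype κ] [DecidableEq κ] [Fintype ι] [DecidableEq ι]

/-- The matrix product `A^{w_1} ⋯ A^{w_N}`. -/
def wordProd (A : J → Matrix κ κ ℂ) {N : ℕ} (w : Fin N → J) : Matrix κ κ ℂ :=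
  (List.ofFn fun j => A (w j)).prod

theorem wordProd_smul (c : ℂ) (A : J → Matrix κ κ ℂ) {N : ℕ} (w : Fin N → J) :
    wordProd (fun x => c • A x) w = c ^ N • wordProd A w := by
  induction N with
  | zero => simp [wordProd]
  | succ N ih =>
    have := ih (fun i => w i.succ)
    simp only [wordProd, List.ofFn_succ, List.prod_cons] at this ⊢
    rw [this, smul_mul_smul_comm, pow_succ']

theorem wordProd_kronecker (A : J → Matrix κ κ ℂ) (C : J → Matrix ι ι ℂ) {N : ℕ} (w : Fin N → J) :
    wordProd (fun x => A x ⊗ₖ C x) w = wordProd A w ⊗ₖ wordProd C w := by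
  induction N with
  | zero => simp [wordProd]
  | succ N ih =>
    have := ih (fun i => w i.succ)
    simp only [wordProd, List.ofFn_succ, List.prod_cons] at this ⊢
    rw [this, Matrix.mul_kronecker_mul]

theorem wordProd_map {R : Type*} [Monoid R] (φ : R →* Matrix κ κ ℂ) (A : J → R) {N : ℕ}
    (w : Fin N → J) :
    wordProd (fun x => φ (A x)) w = φ (List.ofFn fun j => A (w j)).prod := by
  rw [map_list_prod, List.map_ofFn]; rfl

variable [Fintype J]

/-- The mixed transfer matrix `∑ j, A^j ⊗ conj (C^j)`. -/
def mixedTransfer (A : J → Matrix κ κ ℂ) (C : J → Matrix ι ι ℂ) : Matrix (κ × ι) (κ × ι) ℂ :=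
  ∑ j, A j ⊗ₖ (C j).map (starRingEnd ℂ)

theorem mixedTransfer_pow (A : J → Matrix κ κ ℂ) (C : J → Matrix ι ι ℂ) (N : ℕ) :
    mixedTransfer A C ^ N =
      ∑ w : Fin N → J, wordProd A w ⊗ₖ (wordProd C w).map (starRingEnd ℂ) := by
  induction N with
  | zero => simp [wordProd, Matrix.map_one]
  | succ N ih =>
    rw [pow_succ', ih, mixedTransfer, Finset.sum_mul_sum, ← Fintype.sum_prod_type',
      ← (Fin.consEquiv fun _ : Fin (N + 1) => J).sum_comp]
    refine Finset.sum_congr rfl fun x _ => ?_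
    simp [wordProd, Fin.consEquiv, List.ofFn_succ, ← Matrix.mul_kronecker_mul, Matrix.map_mul]

/-- The bridge between spectra and word traces: only the traces of words enter, so tensors with
proportional word traces can be exchanged in an overlap. -/
theorem sum_trace_mul_conj_trace (A : J → Matrix κ κ ℂ) (C : J → Matrix ι ι ℂ) (N : ℕ) :
    ∑ w : Fin N → J, (wordProd A w).trace * starRingEnd ℂ (wordProd C w).trace =
      (mixedTransfer A C ^ N).trace := by
  rw [mixedTransfer_pow, Matrix.trace_sum]
  refine Finset.sum_congr rfl fun w _ => ?_
  rw [Matrix.trace_kronecker]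
  simp [Matrix.trace]

end Words

/-! ### Matrix entries of fermionic matrix product operators. -/

section FermionicOperators

variable {d : ℕ}

theorem sgn_eq_one_or (a : ZMod 2) : sgn a = 1 ∨ sgn a = -1 :=
  neg_one_pow_eq_or ℂ a.val

/-- Only the modulus of the sign matters later, so `ε` is left unspecified; it may depend on `t` but
not on `s`. -/
theorem fermiOp_list_prod_apply (p : Fin d → ZMod 2) {N : ℕ} (n m t : Fin N → Fin d)
    (l : List (Fin N)) (hl : l.Nodup) :
    ∃ ε : ℂ, (ε = 1 ∨ ε = -1) ∧ ∀ s,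
      (l.map fun j => fermiOp p j (n j) (m j)).prod s t =
        if (∀ j ∈ l, t j = m j) ∧ s = (fun i => if i ∈ l then n i else t i) then ε else 0 := by
  induction l with
  | nil => exact ⟨1, Or.inl rfl, fun s => by simp [Matrix.one_apply]⟩
  | cons j l ih =>
    obtain ⟨hj, hl⟩ := List.nodup_cons.mp hl
    obtain ⟨ε, hε, h⟩ := ih hl
    -- The configuration after the factors in `l` have acted; the sign of the next factor is read
    -- off here, not at `t`.
    set u : Fin N → Fin d := fun i => if i ∈ l then n i else t i with hu
    let σ := sgn ((p (n j) + p (m j)) * ∑ i ∈ Finset.univ.filter (fun i => i < j), p (u i))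
    refine ⟨σ * ε, ?_, fun s => ?_⟩
    · rcases sgn_eq_one_or ((p (n j) + p (m j)) *
        ∑ i ∈ Finset.univ.filter (fun i => i < j), p (u i)) with h1 | h1 <;>
        rcases hε with h2 | h2 <;> simp [σ, h1, h2]
    · have huj : u j = t j := by simp [hu, hj]
      have hupd : Function.update u j (n j) = fun i => if i ∈ j :: l then n i else t i := by
        funext i
        by_cases hi : i = j
        · subst hi; simp
        · simp [hu, hi]
      rw [List.map_cons, List.prod_cons, Matrix.mul_apply, Finset.sum_eq_single u]
      · rw [h u]
        simp only [fermiOp, Matrix.of_apply, huj, hupd, List.forall_mem_cons]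
        rw [ite_zero_mul_ite_zero]
        exact if_congr (by tauto) rfl rfl
      · intro v _ hv
        simp [h, hv]
      · simp

/-- The sign of `f₁^{n₁,m₁} ⋯ f_N^{n_N,m_N}` relative to the matrix unit at `(n, m)`. -/
def fermiSign (p : Fin d → ZMod 2) {N : ℕ} (n m : Fin N → Fin d) : ℂ :=
  (List.ofFn fun j => fermiOp p j (n j) (m j)).prod n m

theorem fermiSign_eq_one_or (p : Fin d → ZMod 2) {N : ℕ} (n m : Fin N → Fin d) :
    fermiSign p n m = 1 ∨ fermiSign p n m = -1 := by
  obtain ⟨ε, hε, h⟩ := fermiOp_list_prod_apply p n m m _ (List.nodup_finRange N)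
  rw [fermiSign, List.ofFn_eq_map, h]
  simpa using hε

theorem fermiOp_prod_apply (p : Fin d → ZMod 2) {N : ℕ} (n m s t : Fin N → Fin d) :
    (List.ofFn fun j => fermiOp p j (n j) (m j)).prod s t =
      if t = m ∧ s = n then fermiSign p n m else 0 := by
  split_ifs with h
  · rw [h.1, h.2, fermiSign]
  · obtain ⟨ε, hε, h'⟩ := fermiOp_list_prod_apply p n m t _ (List.nodup_finRange N)
    rw [List.ofFn_eq_map, h', if_neg]
    simpa [← funext_iff] using h

variable {κ ι : Type} [Fintype κ] [DecidableEq κ] [Fintype ι] [DecidableEq ι]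

theorem fMPO_smul_one_apply (p : Fin d → ZMod 2) (c : ℂ) (U : Fin d × Fin d → Matrix κ κ ℂ)
    {N : ℕ} (s t : Fin N → Fin d) :
    fMPO p (c • 1) U N s t =
      fermiSign p s t * (c * (wordProd U fun j => (s j, t j)).trace) := by
  simp only [fMPO, Matrix.sum_apply, Matrix.smul_apply, fermiOp_prod_apply, smul_eq_mul]
  rw [Finset.sum_eq_single s, Finset.sum_eq_single t]
  · simp [wordProd, mul_comm]
  · intro m _ hm; simp [hm.symm]
  · simp
  · intro n _ hn; simp [hn.symm]
  · simp

theorem trace_wordProd_eq_of_fMPO_eq {p : Fin d → ZMod 2} {c c' : ℂ}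
    {U : Fin d × Fin d → Matrix κ κ ℂ} {V : Fin d × Fin d → Matrix ι ι ℂ} {N : ℕ}
    (h : fMPO p (c • 1) U N = fMPO p (c' • 1) V N) (w : Fin N → Fin d × Fin d) :
    c * (wordProd U w).trace = c' * (wordProd V w).trace := by
  have h1 := congrFun (congrFun h fun j => (w j).1) fun j => (w j).2
  rw [fMPO_smul_one_apply, fMPO_smul_one_apply] at h1
  refine mul_left_cancel₀ ?_ h1
  rcases fermiSign_eq_one_or p (fun j => (w j).1) fun j => (w j).2 with h | h <;> simp [h]

/-- Take the trace of `U U† = 1`: each entry meets its own conjugate, so its sign squares to one. -/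
theorem normSq_mul_trace_mixedTransfer_pow_of_unitary {p : Fin d → ZMod 2} {c : ℂ}
    {U : Fin d × Fin d → Matrix κ κ ℂ} {N : ℕ}
    (h : fMPO p (c • 1) U N ∈ Matrix.unitaryGroup (Fin N → Fin d) ℂ) :
    (c * starRingEnd ℂ c) * (mixedTransfer U U ^ N).trace = (d : ℂ) ^ N := by
  have h1 := congrArg Matrix.trace (Matrix.mem_unitaryGroup_iff.mp h)
  have h2 : (1 : Matrix (Fin N → Fin d) (Fin N → Fin d) ℂ).trace = (d : ℂ) ^ N := by
    simp
  rw [h2] at h1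
  rw [← h1, ← sum_trace_mul_conj_trace,
    ← (Equiv.arrowProdEquivProdArrow (Fin N) (fun _ => Fin d) fun _ => Fin d).symm.sum_comp,
    Fintype.sum_prod_type, Finset.mul_sum]
  refine Finset.sum_congr rfl fun s _ => ?_
  rw [Finset.mul_sum, Matrix.diag_apply, Matrix.mul_apply]
  refine Finset.sum_congr rfl fun t _ => ?_
  rw [Matrix.star_apply, fMPO_smul_one_apply]
  change _ * (_ * _) = _ * starRingEnd ℂ _
  rcases fermiSign_eq_one_or p s t with h | h <;>
    simp [h, Equiv.arrowProdEquivProdArrow] <;> ring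

end FermionicOperators

/-! ### Word traces of even tensors and of tensors of type II. -/

section Parity

theorem mixedTransfer_smul {J κ : Type} [Fintype J] (c : ℂ) (A : J → Matrix κ κ ℂ) :
    mixedTransfer (fun j => c • A j) (fun j => c • A j) =
      (c * starRingEnd ℂ c) • mixedTransfer A A := by
  rw [mixedTransfer, mixedTransfer, Finset.smul_sum]
  refine Finset.sum_congr rfl fun j _ => ?_
  ext x y
  simp [Matrix.kroneckerMap_apply]
  ring

variable {J κ : Type} [Fintype κ] [DecidableEq κ]

theorem sgn_add (a b : ZMod 2) : sgn (a + b) = sgn a * sgn b := by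
  revert a b
  have h (a b : ZMod 2) : (a + b).val % 2 = (a.val + b.val) % 2 := by revert a b; decide
  intro a b
  rw [sgn, sgn, sgn, ← pow_add, neg_one_pow_eq_pow_mod_two, h, ← neg_one_pow_eq_pow_mod_two]

theorem parityOp_mul_self (q : κ → ZMod 2) : parityOp q * parityOp q = 1 := by
  rw [parityOp, Matrix.diagonal_mul_diagonal, ← Matrix.diagonal_one]
  congr 1
  funext α
  rcases sgn_eq_one_or (q α) with h | h <;> simp [h]

theorem IsEvenTensor.smul {π : J → ZMod 2} {q : κ → ZMod 2} {A : J → Matrix κ κ ℂ}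
    (h : IsEvenTensor π q A) (c : ℂ) : IsEvenTensor π q fun j => c • A j := fun j => by
  rw [mul_smul_comm, h j, smul_mul_assoc, smul_comm]

theorem IsEvenTensor.parityOp_mul_wordProd {π : J → ZMod 2} {q : κ → ZMod 2}
    {A : J → Matrix κ κ ℂ} (h : IsEvenTensor π q A) {N : ℕ} (w : Fin N → J) :
    parityOp q * wordProd A w = sgn (∑ i, π (w i)) • (wordProd A w * parityOp q) := by
  induction N with
  | zero => simp [wordProd, sgn]
  | succ N ih =>
    have := ih fun i => w i.succ
    simp only [wordProd, List.ofFn_succ, List.prod_cons, Fin.sum_univ_succ] at this ⊢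
    rw [← mul_assoc, h, smul_mul_assoc, mul_assoc, this, mul_smul_comm, smul_smul, sgn_add,
      mul_assoc]

/-- Conjugation by the parity operator preserves the trace but flips the sign of an odd word. -/
theorem IsEvenTensor.trace_wordProd_eq_zero {π : J → ZMod 2} {q : κ → ZMod 2}
    {A : J → Matrix κ κ ℂ} (h : IsEvenTensor π q A) {N : ℕ} {w : Fin N → J}
    (hw : ∑ i, π (w i) ≠ 0) : (wordProd A w).trace = 0 := by
  have h1 := h.parityOp_mul_wordProd w
  have h2 : ∑ i, π (w i) = 1 := by
    generalize (∑ i, π (w i)) = a at hw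
    revert a; decide
  rw [h2] at h1
  have h3 : (wordProd A w).trace = -(wordProd A w).trace := by
    calc (wordProd A w).trace = (parityOp q * (parityOp q * wordProd A w)).trace := by
          rw [← mul_assoc, parityOp_mul_self, one_mul]
      _ = (parityOp q * -(wordProd A w * parityOp q)).trace := by
          rw [h1]; simp [sgn, ZMod.val_one]
      _ = -(wordProd A w).trace := by
          rw [mul_neg, Matrix.trace_neg, Matrix.trace_mul_comm, mul_assoc, parityOp_mul_self,
            mul_one]
  exact self_eq_neg.mp h3

theorem pow_val_add {R : Type*} [Monoid R] {x : R} (hx : x * x = 1) (a b : ZMod 2) :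
    x ^ (a + b).val = x ^ a.val * x ^ b.val := by
  have h (a b : ZMod 2) :
      (a + b).val = a.val + b.val ∨ (a + b).val = 0 ∧ a.val = 1 ∧ b.val = 1 := by
    revert a b; decide
  rcases h a b with h | ⟨h1, h2, h3⟩
  · rw [h, pow_add]
  · rw [h1, h2, h3, pow_zero, pow_one, hx]

theorem wordProd_pow_val {π : J → ZMod 2} {x : Matrix κ κ ℂ} (hx : x * x = 1) {N : ℕ}
    (w : Fin N → J) : wordProd (fun j => x ^ (π j).val) w = x ^ (∑ i, π (w i)).val := by
  induction N with
  | zero => simp [wordProd]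
  | succ N ih =>
    have := ih fun i => w i.succ
    simp only [wordProd, List.ofFn_succ, List.prod_cons, Fin.sum_univ_succ] at this ⊢
    rw [this, pow_val_add hx]

theorem trace_wordProd_typeIITensor {d b : ℕ} (p : Fin d → ZMod 2)
    (M : Fin d × Fin d → Matrix (Fin b) (Fin b) ℂ) {N : ℕ} (w : Fin N → Fin d × Fin d) :
    (wordProd (typeIITensor p M) w).trace =
      if ∑ i, opParity p (w i) = 0 then 2 * (wordProd M w).trace else 0 := by
  have hx : (!![0, 1; 1, 0] : Matrix (Fin 2) (Fin 2) ℂ) * !![0, 1; 1, 0] = 1 := by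
    simp [Matrix.one_fin_two]
  have h : wordProd (typeIITensor p M) w = _ := wordProd_kronecker _ M w
  rw [h, wordProd_pow_val hx, Matrix.trace_kronecker]
  split_ifs with h0
  · simp [h0]
  · have h1 : ∑ i, opParity p (w i) = 1 := by
      generalize (∑ i, opParity p (w i)) = a at h0
      revert a; decide
    simp [h1, ZMod.val_one, Matrix.trace_fin_two]

end Parity

/-! ### Canonical blocks: multiplicities, normality and irreducibility. -/

section Blocks

variable {J κ : Type} [Fintype κ] [DecidableEq κ]

theorem trace_wordProd_blockDiagonal' {r : ℕ} {b : Fin r → ℕ} (e : (Σ k : Fin r, Fin (b k)) ≃ κ)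
    (B : (k : Fin r) → J → Matrix (Fin (b k)) (Fin (b k)) ℂ) {N : ℕ} (w : Fin N → J) :
    (wordProd (fun j => Matrix.reindex e e (Matrix.blockDiagonal' fun k => B k j)) w).trace =
      ∑ k, (wordProd (B k) w).trace := by
  let φ := ((Matrix.reindexAlgEquiv ℂ ℂ e).toMulEquiv.toMonoidHom).comp
    (Matrix.blockDiagonal'RingHom (fun k => Fin (b k)) ℂ).toMonoidHom
  have h : wordProd (fun j => Matrix.reindex e e (Matrix.blockDiagonal' fun k => B k j)) w = _ :=
    wordProd_map φ (fun j k => B k j) w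
  have h2 (k : Fin r) : (List.ofFn fun j => fun k => B k (w j)).prod k = wordProd (B k) w := by
    rw [Pi.list_prod_apply, List.map_ofFn]; rfl
  rw [h]
  have h3 (X : (k : Fin r) → Matrix (Fin (b k)) (Fin (b k)) ℂ) :
      (φ X).trace = ∑ k, (X k).trace := by
    change (Matrix.reindex e e (Matrix.blockDiagonal' X)).trace = _
    rw [Matrix.reindex_apply, Matrix.trace, ← e.sum_comp]
    simp [Fintype.sum_sigma, Matrix.trace]
  rw [h3]
  exact Finset.sum_congr rfl fun k _ => by rw [h2]

theorem sum_map_pow_eq_count {R : Multiset ℂ} (h : ∀ z ∈ R, z ≠ 0 → z = 1) {N : ℕ} (hN : 1 ≤ N) :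
    (R.map fun z => z ^ N).sum = R.count 1 := by
  induction R using Multiset.induction with
  | empty => simp
  | cons z R ih =>
    rw [Multiset.map_cons, Multiset.sum_cons, ih fun y hy => h y (Multiset.mem_cons_of_mem hy)]
    by_cases hz : z = 0
    · simp [hz, Nat.one_le_iff_ne_zero.mp hN]
    · simp [h z (Multiset.mem_cons_self z R) hz, add_comm]

/-- `n k` is the multiplicity of the eigenvalue `1` in row `k` of the matrix of mixed transfer
matrices; the last clause identifies it with the overlap of block `k` and the whole tensor. -/
theorem exists_multiplicity_of_trace_pow [Fintype J] {r : ℕ} {b : Fin r → ℕ}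
    {T : J → Matrix κ κ ℂ} {B : (k : Fin r) → J → Matrix (Fin (b k)) (Fin (b k)) ℂ}
    (hT : ∀ (N : ℕ) (w : Fin N → J), (wordProd T w).trace = ∑ k, (wordProd (B k) w).trace)
    {a : ℂ} (ha : ∀ N : ℕ, 1 ≤ N → (mixedTransfer T T ^ N).trace = a)
    (hB : ∀ k, ∃ z ∈ (mixedTransfer (B k) (B k)).charpoly.roots, z ≠ 0) :
    ∃ n : Fin r → ℕ, (∀ k, 1 ≤ n k) ∧ ∑ k, (n k : ℂ) = a ∧
      ∀ k (N : ℕ), 1 ≤ N → (mixedTransfer (B k) T ^ N).trace = n k := by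
  classical
  let R (k : Fin r) : Multiset ℂ := ∑ l, (mixedTransfer (B k) (B l)).charpoly.roots
  have hR (k : Fin r) (N : ℕ) : (mixedTransfer (B k) T ^ N).trace =
      ((R k).map fun z => z ^ N).sum := by
    have h1 : ((R k).map fun z => z ^ N).sum =
        ∑ l, ((mixedTransfer (B k) (B l)).charpoly.roots.map fun z => z ^ N).sum :=
      map_sum ((Multiset.sumAddMonoidHom : Multiset ℂ →+ ℂ).comp (Multiset.mapAddMonoidHom (· ^ N))) _ _
    simp only [h1, ← trace_pow_eq_sum_roots, ← sum_trace_mul_conj_trace, hT, map_sum,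
      Finset.mul_sum]
    exact Finset.sum_comm
  have htot (N : ℕ) (hN : 1 ≤ N) : ((∑ k, R k).map fun z => z ^ N).sum = a := by
    have h1 : ((∑ k, R k).map fun z => z ^ N).sum = ∑ k, ((R k).map fun z => z ^ N).sum :=
      map_sum ((Multiset.sumAddMonoidHom : Multiset ℂ →+ ℂ).comp (Multiset.mapAddMonoidHom (· ^ N))) _ _
    rw [h1, ← ha N hN, ← sum_trace_mul_conj_trace]
    simp only [← hR, ← sum_trace_mul_conj_trace]
    rw [Finset.sum_comm]
    exact Finset.sum_congr rfl fun w _ => by rw [hT N w, Finset.sum_mul]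
  -- Multiplicities cannot cancel, so what holds for the union of all rows holds for each row.
  have hone (k : Fin r) (z : ℂ) (hz : z ∈ R k) (hz0 : z ≠ 0) : z = 1 := by
    by_contra h
    have h1 := count_eq_of_power_sums htot hz0
    rw [if_neg h, Nat.cast_eq_zero, Multiset.count_eq_zero] at h1
    exact h1 (Multiset.mem_sum.mpr ⟨k, Finset.mem_univ k, hz⟩)
  refine ⟨fun k => (R k).count 1, fun k => ?_, ?_, fun k N hN => ?_⟩
  · obtain ⟨z, hz, hz0⟩ := hB k
    have h1 : z ∈ R k := Multiset.mem_sum.mpr ⟨k, Finset.mem_univ k, hz⟩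
    exact Multiset.one_le_count_iff_mem.mpr (hone k z h1 hz0 ▸ h1)
  · have h1 := count_eq_of_power_sums htot one_ne_zero
    rw [if_pos rfl, Multiset.count_sum', Nat.cast_sum] at h1
    exact h1
  · rw [hR, sum_map_pow_eq_count (hone k) hN]

theorem IsGradedNormal.exists_root_smul [Fintype J] {π : J → ZMod 2} {q : κ → ZMod 2}
    {B : J → Matrix κ κ ℂ} (h : IsGradedNormal π q B) {c : ℂ} (hc : c ≠ 0) :
    ∃ z ∈ (mixedTransfer (fun j => c • B j) fun j => c • B j).charpoly.roots, z ≠ 0 := by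
  have h1 : (1 : ℂ) ∈ (transferMatrix B).charpoly.roots := by
    rcases h with h | h <;>
    exact (Multiset.mem_filter.mp (h.peripheral ▸ Multiset.mem_replicate.mpr ⟨by decide, rfl⟩)).1
  have hcc : c * starRingEnd ℂ c ≠ 0 := mul_ne_zero hc (by simpa using hc)
  -- The eigenvalue `1` of the normal block, rescaled by `|c|²`.
  refine ⟨c * starRingEnd ℂ c, ?_, hcc⟩
  rw [Polynomial.mem_roots (Matrix.charpoly_monic _).ne_zero,
    ← Matrix.mem_spectrum_iff_isRoot_charpoly] at h1 ⊢
  rw [mixedTransfer_smul]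
  have h2 := (spectrum.smul_mem_smul_iff (r := Units.mk0 _ hcc)).mpr h1
  simp only [Units.smul_def, Units.val_mk0, smul_eq_mul, mul_one] at h2
  exact h2

theorem isGradedNormalWith_of_trace_pow [Fintype J] {π : J → ZMod 2} {q : κ → ZMod 2}
    {T : J → Matrix κ κ ℂ} (hev : IsEvenTensor π q T) (hirr : IsGradedIrreducible q T) {c : ℕ}
    (hc : c ≠ 0) (h : ∀ N : ℕ, 1 ≤ N → (mixedTransfer T T ^ N).trace = c) :
    IsGradedNormalWith c π q T := by
  classical
  have hcount (z : ℂ) (hz : z ≠ 0) :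
      (transferMatrix T).charpoly.roots.count z = if z = 1 then c else 0 := by
    have := count_eq_of_power_sums (R := (transferMatrix T).charpoly.roots) (a := c)
      (fun N hN => by rw [← trace_pow_eq_sum_roots]; exact h N hN) hz
    split_ifs at this ⊢ <;> exact_mod_cast this
  have hmem (z : ℂ) (hz : z ∈ spectrum ℂ (transferMatrix T)) : z = 0 ∨ z = 1 := by
    rw [Matrix.mem_spectrum_iff_isRoot_charpoly,
      ← Polynomial.mem_roots (Matrix.charpoly_monic _).ne_zero] at hz
    by_contra! hne
    have := hcount z hne.1
    rw [if_neg hne.2, Multiset.count_eq_zero] at this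
    exact this hz
  have hone : (1 : ℂ) ∈ spectrum ℂ (transferMatrix T) := by
    rw [Matrix.mem_spectrum_iff_isRoot_charpoly,
      ← Polynomial.mem_roots (Matrix.charpoly_monic _).ne_zero, ← Multiset.count_ne_zero,
      hcount 1 one_ne_zero]
    simpa using hc
  refine ⟨hev, hirr, le_antisymm ?_ ?_, ?_⟩
  · refine iSup₂_le fun z hz => ?_
    rcases hmem z hz with rfl | rfl <;> simp
  · exact le_iSup₂_of_le (f := fun z _ => ((‖z‖₊ : NNReal) : ENNReal)) 1 hone (by simp)
  · ext z
    rw [Multiset.count_filter, Multiset.count_replicate]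
    by_cases hz : z = 1
    · subst hz; simp [hcount 1 one_ne_zero]
    · rw [if_neg (Ne.symm hz)]
      split_ifs with h1
      · rw [hcount z (by rintro rfl; simp at h1), if_neg hz]
      · rfl

theorem IsGradedIrreducible.reindex {ι : Type} [Fintype ι] [DecidableEq ι] (e : ι ≃ κ)
    {q : κ → ZMod 2} {B : J → Matrix ι ι ℂ} {c : ℂ} (hc : c ≠ 0)
    (h : IsGradedIrreducible (fun i => q (e i)) B) :
    IsGradedIrreducible q fun j => Matrix.reindex e e (c • B j) := by
  intro P hP hZ hinv
  let φ : Matrix κ κ ℂ ≃ₐ[ℂ] Matrix ι ι ℂ := Matrix.reindexAlgEquiv ℂ ℂ e.symm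
  have hφ (X : Matrix ι ι ℂ) : φ (Matrix.reindex e e X) = X := by
    ext; simp [φ]
  have hφZ : φ (parityOp q) = parityOp fun i => q (e i) := by
    ext i j
    simp [φ, parityOp, Matrix.diagonal_apply]
  have h1 := h (φ P) ⟨?_, ?_⟩ ?_ fun j => ?_
  · exact h1.imp (fun h => φ.injective (by rw [h, map_zero]))
      fun h => φ.injective (by rw [h, map_one])
  · have := congrArg φ hP.isIdempotentElem
    rwa [map_mul] at this
  · have := congrArg φ hP.isSelfAdjoint
    exact this
  · rw [← hφZ]; exact hZ.map φ
  · have := congrArg φ (hinv j)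
    simp only [map_mul, hφ, smul_mul_assoc, mul_smul_comm] at this
    exact smul_right_injective _ hc this

end Blocks

/-! ### Reduction to a single block and the parity argument for type II. -/

section Main

theorem complex_exp_mul_I_mul_conj (α : ℝ) :
    Complex.exp (α * Complex.I) * starRingEnd ℂ (Complex.exp (α * Complex.I)) = 1 := by
  rw [Complex.mul_conj, Complex.normSq_eq_norm_sq, Complex.norm_exp_ofReal_mul_I]
  simp

theorem trace_mixedTransfer_normalized_pow {d : ℕ} (hd : 1 ≤ d) {κ : Type} [Fintype κ]
    [DecidableEq κ] {p : Fin d → ZMod 2} {U : Fin d × Fin d → Matrix κ κ ℂ} {c a : ℂ}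
    (hca : a * (c * starRingEnd ℂ c) = 1) {N : ℕ}
    (h : fMPO p (c • 1) U N ∈ Matrix.unitaryGroup (Fin N → Fin d) ℂ) :
    (mixedTransfer (fun x => ((Real.sqrt (d : ℝ) : ℝ) : ℂ)⁻¹ • U x)
      (fun x => ((Real.sqrt (d : ℝ) : ℝ) : ℂ)⁻¹ • U x) ^ N).trace = a := by
  have hd0 : (d : ℂ) ≠ 0 := by exact_mod_cast (by omega : d ≠ 0)
  have hs : ((Real.sqrt (d : ℝ) : ℝ) : ℂ)⁻¹ * starRingEnd ℂ ((Real.sqrt (d : ℝ) : ℝ) : ℂ)⁻¹ =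
      (d : ℂ)⁻¹ := by
    rw [map_inv₀, Complex.conj_ofReal, ← mul_inv, ← Complex.ofReal_mul,
      Real.mul_self_sqrt (Nat.cast_nonneg d), Complex.ofReal_natCast]
  have h1 := normSq_mul_trace_mixedTransfer_pow_of_unitary h
  have h2 : (mixedTransfer U U ^ N).trace = a * (d : ℂ) ^ N := by
    rw [← h1, ← mul_assoc, hca, one_mul]
  rw [mixedTransfer_smul, hs, smul_pow, Matrix.trace_smul, h2, smul_eq_mul, inv_pow]
  field_simp

/-- A canonical form all of whose blocks carry the full multiplicity of the peripheral spectrum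
consists of a single block. -/
theorem isGradedNormalWith_of_canonicalForm {J κ : Type} [Fintype J] [Fintype κ] [DecidableEq κ]
    {π : J → ZMod 2} {q : κ → ZMod 2} {T : J → Matrix κ κ ℂ}
    (hcf : IsGradedCanonicalForm π q T) {c : ℕ} (hc : c ≠ 0)
    (h : ∀ N : ℕ, 1 ≤ N → (mixedTransfer T T ^ N).trace = c)
    (hblock : ∀ (b : ℕ) (q' : Fin b → ZMod 2) (B : J → Matrix (Fin b) (Fin b) ℂ) (n : ℕ),
      IsEvenTensor π q' B → 1 ≤ n →
      (∀ N : ℕ, 1 ≤ N → (mixedTransfer B T ^ N).trace = n) → c ≤ n) :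
    IsGradedNormalWith c π q T := by
  obtain ⟨hev, r, b, e, μ, B, hμ, hT, hB⟩ := hcf
  have hBeven (k : Fin r) : IsEvenTensor π (fun a => q (e ⟨k, a⟩)) (B k) :=
    (hB k).elim (fun h => h.even) fun h => h.even
  obtain ⟨n, hn1, hnsum, hn⟩ := exists_multiplicity_of_trace_pow
    (T := T) (B := fun k j => μ k • B k j)
    (fun N w => by rw [funext hT]; exact trace_wordProd_blockDiagonal' e (fun k j => μ k • B k j) w)
    h fun k => (hB k).exists_root_smul (hμ k)
  have hnc (k : Fin r) : c ≤ n k := hblock _ _ _ _ ((hBeven k).smul (μ k)) (hn1 k) (hn k)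
  have hnsum' : ∑ k, n k = c := by exact_mod_cast hnsum
  -- Each of the `r` blocks takes at least `c` of a total of `c`.
  have hr : r = 1 := by
    have h1 : r * c ≤ 1 * c := by
      calc r * c = ∑ _k : Fin r, c := by simp
        _ ≤ ∑ k, n k := Finset.sum_le_sum fun k _ => hnc k
        _ = 1 * c := by rw [hnsum', one_mul]
    have h2 : r ≠ 0 := by
      rintro rfl
      exact hc (by simpa using hnsum'.symm)
    have := Nat.le_of_mul_le_mul_right h1 (Nat.pos_of_ne_zero hc)
    omega
  subst hr
  refine isGradedNormalWith_of_trace_pow hev ?_ hc h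
  let e₀ : Fin (b 0) ≃ κ := (Equiv.uniqueSigma fun k => Fin (b k)).symm.trans e
  have hirr : IsGradedIrreducible (fun a => q (e₀ a)) (B 0) :=
    (hB 0).elim (fun h => h.irreducible) fun h => h.irreducible
  have hTe : T = fun j => Matrix.reindex e₀ e₀ (μ 0 • B 0 j) := by
    funext j
    rw [hT j]
    ext x y
    obtain ⟨x, rfl⟩ := e₀.surjective x
    obtain ⟨y, rfl⟩ := e₀.surjective y
    have h1 (z : Fin (b 0)) : e.symm (e₀ z) = ⟨0, z⟩ := e.symm_apply_apply _
    simp only [Matrix.reindex_apply, Matrix.submatrix_apply, h1, Equiv.symm_apply_apply,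
      Matrix.blockDiagonal'_apply_eq]
  rw [hTe]
  exact hirr.reindex e₀ (hμ 0)

theorem IsGradedCanonicalForm.smul {J κ : Type} [Fintype J] [Fintype κ] [DecidableEq κ]
    {π : J → ZMod 2} {q : κ → ZMod 2} {A : J → Matrix κ κ ℂ}
    (h : IsGradedCanonicalForm π q A) {c : ℂ} (hc : c ≠ 0) :
    IsGradedCanonicalForm π q fun j => c • A j := by
  obtain ⟨hev, r, b, e, μ, B, hμ, hA, hB⟩ := h
  refine ⟨hev.smul c, r, b, e, fun k => c * μ k, B, fun k => mul_ne_zero hc (hμ k),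
    fun j => ?_, hB⟩
  have h1 : (fun k => (c * μ k) • B k j) = c • fun k => μ k • B k j := by
    funext k; simp [mul_smul]
  simp only [hA, h1, Matrix.blockDiagonal'_smul]
  rfl

/-- The overlap of an even tensor with a tensor of type II is twice a sum of `N`-th powers, so its
multiplicity is even. -/
theorem two_le_of_typeII {d : ℕ} {κ : Type} [Fintype κ] [DecidableEq κ] {p : Fin d → ZMod 2}
    {T : Fin d × Fin d → Matrix κ κ ℂ} {b : ℕ} {M : Fin d × Fin d → Matrix (Fin b) (Fin b) ℂ}
    {φ : ℂ} (hφ : ‖φ‖ = 1)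
    (hTM : ∀ (N : ℕ), 1 ≤ N → ∀ w : Fin N → Fin d × Fin d,
      (wordProd T w).trace = φ * (wordProd (typeIITensor p M) w).trace)
    {ι : Type} [Fintype ι] [DecidableEq ι] {q : ι → ZMod 2} {B : Fin d × Fin d → Matrix ι ι ℂ}
    (hB : IsEvenTensor (opParity p) q B) {n : ℕ} (hn : 1 ≤ n)
    (h : ∀ N : ℕ, 1 ≤ N → (mixedTransfer B T ^ N).trace = n) : 2 ≤ n := by
  have hφ0 : starRingEnd ℂ φ ≠ 0 := by
    rw [Ne, map_eq_zero, ← norm_eq_zero, hφ]; exact one_ne_zero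
  have h1 (N : ℕ) (hN : 1 ≤ N) :
      (mixedTransfer B M ^ N).trace = n / (2 * starRingEnd ℂ φ) := by
    rw [eq_div_iff (mul_ne_zero two_ne_zero hφ0), ← h N hN, ← sum_trace_mul_conj_trace,
      ← sum_trace_mul_conj_trace, Finset.sum_mul]
    refine Finset.sum_congr rfl fun w _ => ?_
    rw [hTM N hN, trace_wordProd_typeIITensor]
    split_ifs with h0
    · simp only [map_mul, Complex.conj_ofNat]; ring
    -- `M` carries no grading, so its odd words may have nonzero trace; evenness of `B` removes
    -- them.
    · rw [hB.trace_wordProd_eq_zero h0]; simp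
  have h2 := count_eq_of_power_sums (R := (mixedTransfer B M).charpoly.roots)
    (fun N hN => by rw [← trace_pow_eq_sum_roots]; exact h1 N hN) one_ne_zero
  rw [if_pos rfl] at h2
  -- The norm discards the unknown phase: half of `n` is a natural number.
  have h3 := congrArg (‖·‖) h2
  simp only [Complex.norm_natCast, norm_div, norm_mul, RCLike.norm_conj, hφ, mul_one,
    Complex.norm_ofNat] at h3
  rw [eq_div_iff two_ne_zero] at h3
  have h4 : (mixedTransfer B M).charpoly.roots.count 1 * 2 = n := by exact_mod_cast h3
  omega

end Main

end FMPU

end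

theorem mainTheorem8 (d D : ℕ) (hd : 1 ≤ d) (p : Fin d → ZMod 2) (q : Fin D → ZMod 2)
    (U : Fin d × Fin d → Matrix (Fin D) (Fin D) ℂ)
    (hU : FMPU.IsGradedCanonicalForm (FMPU.opParity p) q U) :
    (FMPU.GeneratesTypeI p q U →
      FMPU.IsGradedNormalNondegenerate (FMPU.opParity p) q
        (fun x => (((Real.sqrt (d : ℝ)) : ℝ) : ℂ)⁻¹ • U x)) ∧
    (FMPU.GeneratesTypeII p q U →
      FMPU.IsGradedNormalDegenerate (FMPU.opParity p) q
        (fun x => (((Real.sqrt (d : ℝ)) : ℝ) : ℂ)⁻¹ • U x)) := by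
  have hs : (((Real.sqrt (d : ℝ)) : ℝ) : ℂ)⁻¹ ≠ 0 := by
    refine inv_ne_zero (Complex.ofReal_ne_zero.mpr (Real.sqrt_ne_zero'.mpr ?_))
    exact_mod_cast hd
  constructor
  · rintro ⟨α, h⟩
    refine FMPU.isGradedNormalWith_of_canonicalForm (hU.smul hs) one_ne_zero (fun N hN => ?_)
      fun b q' B n _ hn _ => hn
    refine FMPU.trace_mixedTransfer_normalized_pow hd ?_ (h.unitary N hN)
    rw [FMPU.complex_exp_mul_I_mul_conj]; simp
  · rintro ⟨α, h, b, β, M, hM, hUM⟩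
    have h2 : ((Real.sqrt 2 : ℝ) : ℂ) ≠ 0 := by simp
    refine FMPU.isGradedNormalWith_of_canonicalForm (hU.smul hs) two_ne_zero (fun N hN => ?_)
      fun b' q' B n hB hn hBn => ?_
    · refine FMPU.trace_mixedTransfer_normalized_pow hd ?_ (h.unitary N hN)
      have h3 : ((Real.sqrt 2 : ℝ) : ℂ) * ((Real.sqrt 2 : ℝ) : ℂ) = 2 := by
        rw [← Complex.ofReal_mul, Real.mul_self_sqrt zero_le_two]; simp
      rw [map_div₀, Complex.conj_ofReal, div_mul_div_comm, FMPU.complex_exp_mul_I_mul_conj, h3]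
      norm_num
    -- `φ` is the quotient of the two boundary scalars, in which `√2` cancels; `M` is rescaled along
    -- with `U`.
    · refine FMPU.two_le_of_typeII (φ := Complex.exp (β * Complex.I) / Complex.exp (α * Complex.I))
        (M := fun x => (((Real.sqrt (d : ℝ)) : ℝ) : ℂ)⁻¹ • M x) ?_ (fun N hN w => ?_) hB hn hBn
      · rw [norm_div, Complex.norm_exp_ofReal_mul_I, Complex.norm_exp_ofReal_mul_I, div_one]
      · have h3 := FMPU.trace_wordProd_eq_of_fMPO_eq (hUM N hN) w
        have h4 : FMPU.typeIITensor p (fun x => (((Real.sqrt (d : ℝ)) : ℝ) : ℂ)⁻¹ • M x) =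
            fun x => (((Real.sqrt (d : ℝ)) : ℝ) : ℂ)⁻¹ • FMPU.typeIITensor p M x := by
          funext x
          exact Matrix.kronecker_smul _ _ _
        rw [h4, FMPU.wordProd_smul, FMPU.wordProd_smul, Matrix.trace_smul, Matrix.trace_smul,
          smul_eq_mul, smul_eq_mul, mul_left_comm]
        congr 1
        have h5 := Complex.exp_ne_zero (α * Complex.I)
        field_simp at h3 ⊢
        linear_combination h3
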